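/- Consider the following online learning game with a finite set $\mathcal X$ of at least two actions (for example, two actions) and with $T+1$ rounds, where $T>10$ is an integer. A loss sequence consists of functions $f_t:\mathcal X^t\to[0,1]$, $1\le t\le T+1$; it has memory of size $1$ if $f_t(x_1,\dots,x_t)$ depends only on the two most recent actions $x_{t-1},x_t$ (only on $x_1$ if $t=1$). In round $t$ the player chooses an action $X_t$, which may depend on internal randomness and on everything observed before, suffers the loss $f_t(X_1,\dots,X_t)$ and then, as full-information feedback, observes $f_t(X_1,\dots,X_{t-1},x)$ for every $x\in\mathcal X$. The policy regret is $$R_{T+1}=\sum_{t=1}^{T+1}f_t(X_1,\dots,X_t)-\min_{x\in\mathcal X}\sum_{t=1}^{T+1}f_t(x,\dots,x).$$ Then for every integer $T>10$ and every randomized player strategy there is a (deterministic) loss sequence $f_1,\dots,f_{T+1}$ with values in $[0,1]$ and memory of size $1$ such that $$\mathbb E[R_{T+1}]\ \ge\ \frac{T^{2/3}}{500\,\log_2 T},$$ where the expectation is over the player's internal randomness. -/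

import Mathlib

open MeasureTheory

noncomputable section

namespace OnlineLearning

/-- A (possibly adaptive) loss sequence over the action set `A`. Rounds are numbered from `0`, so
the loss of round `t` is a function of the `t + 1` actions played in the rounds `0, …, t`. In a game
with `n` rounds only the entries `0, …, n - 1` are used. -/
abbrev LossSequence (A : Type*) := (t : ℕ) → (Fin (t + 1) → A) → ℝ

/-- The loss functions take values in the unit interval. -/
def LossSequence.UnitBounded {A : Type*} (f : LossSequence A) : Prop :=
  ∀ (t : ℕ) (x : Fin (t + 1) → A), f t x ∈ Set.Icc (0 : ℝ) 1

/-- Memory of size `m`: the loss of round `t` depends only on the `m + 1` most recent actions,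
those of the rounds `i` with `t - m ≤ i ≤ t`. -/
def LossSequence.HasMemory {A : Type*} (m : ℕ) (f : LossSequence A) : Prop :=
  ∀ (t : ℕ) (x x' : Fin (t + 1) → A),
    (∀ i : Fin (t + 1), t ≤ (i : ℕ) + m → x i = x' i) → f t x = f t x'

/-- A randomized player with internal randomness `ω ∈ Ω`. In round `t` the action is a function of
`ω`, of the actions `x` of the rounds `0, …, t - 1`, and of the feedback `y` of those rounds, where
`y s a` is the loss that was revealed for the action `a` in round `s`. The action has to be a random
variable for each fixed history. -/
structure RandomizedPlayer (A Ω : Type*) [MeasurableSpace Ω] where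
  act : (t : ℕ) → Ω → (Fin t → A) → (Fin t → A → ℝ) → A
  measurableSet_act : ∀ (t : ℕ) (x : Fin t → A) (y : Fin t → A → ℝ) (a : A),
    MeasurableSet {ω | act t ω x y = a}

/-- Full-information feedback. If the actions of the rounds `0, …, t - 1` were `x`, then for each of
these rounds `s` the player is shown `f_s(x_0, …, x_{s-1}, a)` for all actions `a`. -/
def fullInfoFeedback {A : Type*} (f : LossSequence A) {t : ℕ} (x : Fin t → A) :
    Fin t → A → ℝ :=
  fun s a => f s (Fin.snoc (α := fun _ => A) (fun i : Fin s => x (Fin.castLE s.isLt.le i)) a)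

/-- The actions of the first `t` rounds of the full-information game of `π` against `f`, when the
internal randomness of the player is `ω`. -/
def play {A Ω : Type*} [MeasurableSpace Ω] (π : RandomizedPlayer A Ω) (f : LossSequence A)
    (ω : Ω) : (t : ℕ) → Fin t → A
  | 0 => Fin.elim0
  | t + 1 => Fin.snoc (α := fun _ => A) (play π f ω t)
      (π.act t ω (play π f ω t) (fullInfoFeedback f (play π f ω t)))

/-- The policy regret of `π` against `f` over `n` rounds. The infimum is a minimum, since it is only
used for a finite nonempty `A`. -/
def policyRegret {A Ω : Type*} [MeasurableSpace Ω] (π : RandomizedPlayer A Ω)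
    (f : LossSequence A) (n : ℕ) (ω : Ω) : ℝ :=
  (∑ t ∈ Finset.range n, f t (play π f ω (t + 1)))
    - ⨅ a : A, ∑ t ∈ Finset.range n, f t (fun _ => a)

end OnlineLearning

end

/-!
The adversary is random: a bit `θ`, the better of two arms, and a random walk. The loss of round `t`
is the walk at time `t`, plus an offset of the arm of round `t - 1`, by `δ` larger for the worse arm
than for the better one, plus `1 / 2` if the arm of round `t` differs from that of round `t - 1`. Since it is the previous arm that is
charged, full-information feedback amounts to bandit feedback with a switching cost: a round reveals
the walk plus the offset of a single arm, and as long as the arm is kept, the walk hides the gap.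

The walk is indexed by the dyadic tree in which the parent of `t` is `t` with its lowest binary
digit `1` removed (`parent`, `walk`). The tree has depth about `log₂ T`, so the losses stay bounded
(`abs_walk_le`), and at most about `log₂ T` edges cross any given time, so a change of arm shifts
only that many increments (`card_ne_parent_le`). At all other times the observations have the same
conditional law under both hypotheses.

The two hypotheses are compared through the potential `a * b / (a + b)` of their likelihoods `a` and
`b`. It is homogeneous of degree one, so an observation without a shift preserves its sum over the
outcomes; a shift lowers it by at most a multiple of `(a + b)` times the squared Hellinger distance
between the noise and its shift (`potential_noise_ge`), which is `O (1 / k ^ 2)` for the noise of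
width `k` used here, whose weights are the squares of a tent function. As the potential is at most
`min a b`, at the end of the game `δ * T` times the potential is a lower bound for the regret due to
the gap. Backward induction over the rounds (`le_noiseAvg_policyRegret`), in which the shifts are
paid for by the switching costs, thus gives an average regret of almost `δ * T / 4` against every
player with fixed internal randomness. No product measure is needed: the average over the walk is an
iterated finite sum (`noiseAvg`), which commutes with the expectation over the player's randomness.
For `k` of order `T ^ (1 / 3)` and `δ` of order `1 / (T ^ (1 / 3) * log₂ T)` all the requirements
hold (`parameter_bounds`). A general action set is mapped onto the two arms.
-/

open MeasureTheory

noncomputable section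

namespace OnlineLearning

/-! ### The dyadic tree and the multi-scale walk -/

/-- The parent of the time `t ≥ 1` in the dyadic tree: `t` with its lowest binary digit `1`
removed. The root is the time `0`. -/
def parent (t : ℕ) : ℕ := t - 2 ^ padicValNat 2 t

lemma parent_lt {t : ℕ} (ht : t ≠ 0) : parent t < t := by
  have : 0 < 2 ^ padicValNat 2 t := by positivity
  unfold parent
  omega

/-- The multi-scale walk driven by the increments `z`: its value at `t` is the sum of `z` over the
nonzero ancestors of `t` in the dyadic tree, `t` included. -/
def walk (z : ℕ → ℤ) : ℕ → ℤ
  | 0 => 0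
  | t + 1 => walk z (parent (t + 1)) + z (t + 1)
decreasing_by exact parent_lt (Nat.succ_ne_zero t)

lemma walk_zero (z : ℕ → ℤ) : walk z 0 = 0 := by rw [walk]

lemma walk_of_ne_zero (z : ℕ → ℤ) {t : ℕ} (ht : t ≠ 0) :
    walk z t = walk z (parent t) + z t := by
  obtain ⟨s, rfl⟩ := Nat.exists_eq_succ_of_ne_zero ht
  rw [Nat.succ_eq_add_one, walk]

lemma walk_congr {z z' : ℕ → ℤ} (t : ℕ) (h : ∀ i ≤ t, z i = z' i) : walk z t = walk z' t := by
  induction t using Nat.strong_induction_on with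
  | _ t ih =>
    rcases eq_or_ne t 0 with rfl | ht
    · rw [walk_zero, walk_zero]
    · have hp := parent_lt ht
      rw [walk_of_ne_zero z ht, walk_of_ne_zero z' ht, h t le_rfl,
        ih _ hp fun i hi => h i (hi.trans hp.le)]

lemma walk_update_of_lt (z : ℕ → ℤ) {s t : ℕ} (h : s < t) (c : ℤ) :
    walk (Function.update z t c) s = walk z s :=
  walk_congr s fun i hi => Function.update_of_ne (by omega) _ _

lemma walk_update_self (z : ℕ → ℤ) {t : ℕ} (ht : t ≠ 0) (c : ℤ) :
    walk (Function.update z t c) t = walk z (parent t) + c := by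
  rw [walk_of_ne_zero _ ht, walk_update_of_lt z (parent_lt ht), Function.update_self]

lemma two_pow_succ_dvd_parent {t : ℕ} (ht : t ≠ 0) : 2 ^ (padicValNat 2 t + 1) ∣ parent t := by
  obtain ⟨r, hr⟩ : 2 ^ padicValNat 2 t ∣ t := pow_padicValNat_dvd
  have hnd : ¬ 2 ^ (padicValNat 2 t + 1) ∣ t := pow_succ_padicValNat_not_dvd ht
  have hodd : ¬ 2 ∣ r := by
    rintro ⟨r', rfl⟩
    exact hnd ⟨r', by rw [pow_succ]; rw [← mul_assoc] at hr; exact hr⟩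
  have h2 : 2 ∣ r - 1 := by omega
  have : parent t = 2 ^ padicValNat 2 t * (r - 1) := by
    rw [Nat.mul_sub, mul_one, ← hr, parent]
  rw [this, pow_succ]
  exact Nat.mul_dvd_mul_left _ h2

/-- Every step to the parent raises the power of two that divides the time, so a time below `2 ^ k`
has at most `k` nonzero ancestors. -/
lemma abs_walk_le_of_dvd {z : ℕ → ℤ} {m : ℕ} (hz : ∀ i, |z i| ≤ m) {k : ℕ} (t : ℕ) :
    ∀ j ≤ k, t < 2 ^ k → 2 ^ j ∣ t → |walk z t| ≤ m * (k - j : ℤ) := by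
  induction t using Nat.strong_induction_on with
  | _ t ih =>
    intro j hjk htk hjt
    have hm : (0 : ℤ) ≤ m := Int.natCast_nonneg m
    rcases eq_or_ne t 0 with rfl | ht
    · rw [walk_zero, abs_zero]
      exact mul_nonneg hm (by omega)
    · have hp := parent_lt ht
      have hjv : j ≤ padicValNat 2 t := (padicValNat_dvd_iff_le ht).1 hjt
      have hvk : padicValNat 2 t < k := by
        by_contra hcon
        have h1 : 2 ^ k ∣ t := (pow_dvd_pow 2 (not_lt.1 hcon)).trans pow_padicValNat_dvd
        exact absurd (Nat.le_of_dvd (Nat.pos_of_ne_zero ht) h1) (by omega)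
      have h1 := ih _ hp (padicValNat 2 t + 1) hvk (hp.trans htk) (two_pow_succ_dvd_parent ht)
      rw [walk_of_ne_zero z ht]
      have h2 : (m : ℤ) * j ≤ m * (padicValNat 2 t : ℤ) :=
        mul_le_mul_of_nonneg_left (by exact_mod_cast hjv) hm
      calc |walk z (parent t) + z t| ≤ |walk z (parent t)| + |z t| := abs_add_le _ _
        _ ≤ m * (k - (padicValNat 2 t + 1 : ℕ) : ℤ) + m := add_le_add h1 (hz t)
        _ ≤ m * (k - j : ℤ) := by rw [Nat.cast_add, Nat.cast_one]; linarith

lemma abs_walk_le {z : ℕ → ℤ} {m : ℕ} (hz : ∀ i, |z i| ≤ m) {t k : ℕ} (ht : t < 2 ^ k) :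
    |walk z t| ≤ m * k := by
  simpa using abs_walk_le_of_dvd hz t 0 (Nat.zero_le k) ht (by simp)

/-- The cut width of the dyadic tree: a time `t` whose edge to its parent crosses `s` is the
smallest multiple of `2 ^ v` that is at least `s`, where `v` is the exponent of `2` in `t`. -/
lemma card_crossing_le {T k : ℕ} (hT : T < 2 ^ k) (s : ℕ) :
    ((Finset.Icc 1 T).filter fun t => parent t < s ∧ s ≤ t).card ≤ k := by
  have key : ((Finset.Icc 1 T).filter fun t => parent t < s ∧ s ≤ t).card
      ≤ (Finset.range k).card := by
    refine Finset.card_le_card_of_injOn (fun t => padicValNat 2 t) ?_ ?_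
    · intro t ht
      simp only [Finset.coe_filter, Finset.mem_Icc, Set.mem_ofPred_eq] at ht
      simp only [Finset.coe_range, Set.mem_Iio]
      by_contra hcon
      have h1 : 2 ^ k ∣ t := (pow_dvd_pow 2 (not_lt.1 hcon)).trans pow_padicValNat_dvd
      exact absurd (Nat.le_of_dvd (by omega) h1) (by omega)
    · intro t ht t' ht' hv
      simp only [Finset.coe_filter, Finset.mem_Icc, Set.mem_ofPred_eq] at ht ht'
      simp only at hv
      obtain ⟨r, hr⟩ : 2 ^ padicValNat 2 t ∣ t := pow_padicValNat_dvd
      obtain ⟨r', hr'⟩ : 2 ^ padicValNat 2 t' ∣ t' := pow_padicValNat_dvd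
      rw [← hv] at hr'
      have h1 : t < s + 2 ^ padicValNat 2 t := by
        have := ht.2.1; unfold parent at this; omega
      have h2 : t' < s + 2 ^ padicValNat 2 t := by
        have := ht'.2.1; unfold parent at this; rw [← hv] at this; omega
      have h3 := ht.2.2
      have h4 := ht'.2.2
      generalize 2 ^ padicValNat 2 t = P at *
      have hrr : r < r' + 1 := by
        by_contra hcon
        have : P * (r' + 1) ≤ P * r := Nat.mul_le_mul_left _ (not_lt.1 hcon)
        rw [mul_add] at this; omega
      have hrr' : r' < r + 1 := by
        by_contra hcon
        have : P * (r + 1) ≤ P * r' := Nat.mul_le_mul_left _ (not_lt.1 hcon)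
        rw [mul_add] at this; omega
      rw [hr, hr', show r = r' by omega]
  simpa using key

/-- A time whose arm differs from the arm at its parent has an edge that crosses a change of arm,
and each change is crossed by at most `k` edges. -/
lemma card_ne_parent_le {α : Type*} [DecidableEq α] (x : ℕ → α) {T k : ℕ} (hT : T < 2 ^ k) :
    ((Finset.Icc 1 T).filter fun t => x t ≠ x (parent t)).card
      ≤ ((Finset.Icc 1 T).filter fun s => x s ≠ x (s - 1)).card * k := by
  have hsub : ((Finset.Icc 1 T).filter fun t => x t ≠ x (parent t)) ⊆
      ((Finset.Icc 1 T).filter fun s => x s ≠ x (s - 1)).biUnion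
        fun s => (Finset.Icc 1 T).filter fun t => parent t < s ∧ s ≤ t := by
    intro t ht
    simp only [Finset.mem_filter, Finset.mem_Icc, Finset.mem_biUnion] at ht ⊢
    obtain ⟨⟨h1, h2⟩, hne⟩ := ht
    by_contra hcon
    push Not at hcon
    have hconst : ∀ s, parent t ≤ s → s ≤ t → x s = x (parent t) := by
      intro s hs
      induction s, hs using Nat.le_induction with
      | base => intro _; rfl
      | succ s hs ih =>
        intro hst
        by_contra hne'
        have := hcon (s + 1) ⟨⟨by omega, by omega⟩, by
          rw [Nat.add_sub_cancel, ih (by omega)]; exact hne'⟩ ⟨h1, h2⟩ (by omega)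
        omega
    exact hne (hconst t (parent_lt (by omega)).le le_rfl)
  refine (Finset.card_le_card hsub).trans (Finset.card_biUnion_le_card_mul _ _ _ ?_)
  intro s _
  exact card_crossing_le hT s

/-! ### Comparison of a noise distribution with its shifts -/

/-- The tent function of half-width `2 * k`. Its square is the unnormalized noise weight; the tent
is Lipschitz, so a shift of the noise by `d` moves the square root of its distribution only by
`O (d / k)` in `ℓ²`. -/
def tent (k : ℕ) (c : ℤ) : ℝ := max 0 (2 * (k : ℝ) - |(c : ℝ)|)

lemma tent_nonneg (k : ℕ) (c : ℤ) : 0 ≤ tent k c := le_max_left _ _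

lemma tent_eq_zero {k : ℕ} {c : ℤ} (hc : c ∉ Finset.Icc (-(2 * k : ℤ)) (2 * k)) :
    tent k c = 0 := by
  refine max_eq_left ?_
  have h : (2 * k : ℤ) ≤ |c| := by
    rw [Finset.mem_Icc, ← abs_le] at hc
    omega
  have : (2 * k : ℝ) ≤ |(c : ℝ)| := by exact_mod_cast h
  linarith

lemma abs_tent_sub_le (k : ℕ) (c d : ℤ) : |tent k c - tent k (c + d)| ≤ |(d : ℝ)| := by
  unfold tent
  refine (abs_max_sub_max_le_max _ _ _ _).trans ?_
  rw [sub_self, abs_zero, max_eq_right (abs_nonneg _)]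
  have h := abs_abs_sub_abs_le ((c : ℝ) + d) c
  rw [add_sub_cancel_left] at h
  push_cast
  rw [sub_sub_sub_cancel_left]
  exact h

/-- The normalizing constant of the noise. -/
def tentMass (k : ℕ) : ℝ := ∑ c ∈ Finset.Icc (-(2 * k : ℤ)) (2 * k), tent k c ^ 2

lemma le_tentMass (k : ℕ) : 2 * (k : ℝ) ^ 3 ≤ tentMass k := by
  have hsub : Finset.Icc (-(k : ℤ)) k ⊆ Finset.Icc (-(2 * k : ℤ)) (2 * k) :=
    Finset.Icc_subset_Icc (by omega) (by omega)
  have h1 : ∑ c ∈ Finset.Icc (-(k : ℤ)) k, tent k c ^ 2 ≤ tentMass k :=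
    Finset.sum_le_sum_of_subset_of_nonneg hsub fun c _ _ => sq_nonneg _
  have h2 : (Finset.Icc (-(k : ℤ)) k).card • ((k : ℝ) ^ 2)
      ≤ ∑ c ∈ Finset.Icc (-(k : ℤ)) k, tent k c ^ 2 := by
    refine Finset.card_nsmul_le_sum _ _ _ fun c hc => ?_
    rw [Finset.mem_Icc, ← abs_le] at hc
    have hc' : |(c : ℝ)| ≤ k := by exact_mod_cast hc
    refine pow_le_pow_left₀ (Nat.cast_nonneg k) ?_ 2
    exact le_max_of_le_right (by linarith)
  have h3 : (Finset.Icc (-(k : ℤ)) k).card = 2 * k + 1 := by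
    rw [Int.card_Icc]; omega
  rw [h3, nsmul_eq_mul] at h2
  push_cast at h2
  nlinarith [sq_nonneg (k : ℝ)]

lemma tentMass_pos {k : ℕ} (hk : k ≠ 0) : 0 < tentMass k := by
  have : (0 : ℝ) < k := by exact_mod_cast Nat.pos_of_ne_zero hk
  exact lt_of_lt_of_le (by positivity) (le_tentMass k)

/-- The probability weights of an increment of the walk. -/
def noise (k : ℕ) (c : ℤ) : ℝ := tent k c ^ 2 / tentMass k

lemma noise_nonneg (k : ℕ) (c : ℤ) : 0 ≤ noise k c :=
  div_nonneg (sq_nonneg _) (Finset.sum_nonneg fun _ _ => sq_nonneg _)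

lemma sum_noise {k : ℕ} (hk : k ≠ 0) :
    ∑ c ∈ Finset.Icc (-(2 * k : ℤ)) (2 * k), noise k c = 1 := by
  unfold noise
  rw [← Finset.sum_div]
  exact div_self (tentMass_pos hk).ne'

lemma noise_eq_zero {k : ℕ} {c : ℤ} (hc : c ∉ Finset.Icc (-(2 * k : ℤ)) (2 * k)) :
    noise k c = 0 := by
  rw [noise, tent_eq_zero hc]; simp

/-- A sum over the support of the noise as a sum over an enlarged interval that is stable under the
shifts in question. -/
lemma sum_eq_sum_shift {k : ℕ} {F : ℤ → ℝ}
    (hF : ∀ c ∉ Finset.Icc (-(2 * k : ℤ)) (2 * k), F c = 0) {d : ℤ} (hd : |d| ≤ 2) :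
    ∑ c ∈ Finset.Icc (-(2 * k : ℤ)) (2 * k), F c
      = ∑ c ∈ Finset.Icc (-(2 * k + 2 : ℤ)) (2 * k + 2), F (c + d) := by
  rw [abs_le] at hd
  have h1 : ∑ c ∈ Finset.Icc (-(2 * k + 2 : ℤ)) (2 * k + 2), F (c + d)
      = ∑ c ∈ Finset.Icc (-(2 * k + 2 : ℤ) + d) (2 * k + 2 + d), F c := by
    rw [← Finset.map_add_right_Icc, Finset.sum_map]
    rfl
  rw [h1]
  exact Finset.sum_subset (Finset.Icc_subset_Icc (by omega) (by omega)) fun c _ hc => hF c hc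

/-- The squared Hellinger distance (up to normalization) of the noise and its shift. -/
lemma sum_sq_tent_sub_le (k : ℕ) {d : ℤ} (hd : |d| ≤ 2) :
    ∑ c ∈ Finset.Icc (-(2 * k + 2 : ℤ)) (2 * k + 2), (tent k c - tent k (c + d)) ^ 2
      ≤ 4 * (4 * k + 5) := by
  have h1 : ∀ c ∈ Finset.Icc (-(2 * k + 2 : ℤ)) (2 * k + 2),
      (tent k c - tent k (c + d)) ^ 2 ≤ 4 := by
    intro c _
    have hd' : |(d : ℝ)| ≤ 2 := by exact_mod_cast hd
    have := abs_le.1 ((abs_tent_sub_le k c d).trans hd')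
    nlinarith [this.1, this.2]
  refine (Finset.sum_le_card_nsmul _ _ _ h1).trans ?_
  have h3 : (Finset.Icc (-(2 * k + 2 : ℤ)) (2 * k + 2)).card = 4 * k + 5 := by
    rw [Int.card_Icc]; omega
  rw [h3, nsmul_eq_mul]
  push_cast
  linarith

/-! ### The potential -/

/-- The potential of the pair `(a, b)` of likelihoods of the two hypotheses: half their harmonic
mean. At `a = b = 0` the quotient is `0`, which is the value wanted there. -/
def potential (a b : ℝ) : ℝ := a * b / (a + b)

lemma potential_le_left {a b : ℝ} (ha : 0 ≤ a) (hb : 0 ≤ b) : potential a b ≤ a := by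
  unfold potential
  rcases (add_nonneg ha hb).eq_or_lt with h | h
  · rw [← h, div_zero]; exact ha
  · rw [div_le_iff₀ h]; nlinarith

lemma potential_le_right {a b : ℝ} (ha : 0 ≤ a) (hb : 0 ≤ b) : potential a b ≤ b := by
  unfold potential
  rcases (add_nonneg ha hb).eq_or_lt with h | h
  · rw [← h, div_zero]; exact hb
  · rw [div_le_iff₀ h]; nlinarith

/-- The first-order expansion of the potential: `r ^ 2` and `s ^ 2` are the probabilities of one
outcome under the two hypotheses. Summed over the outcomes, the second term on the left gives back
`potential a b`. -/
lemma potential_mul_sq_ge {a b r s : ℝ} (ha : 0 < a) (hb : 0 < b) (hr : 0 ≤ r) (hs : 0 ≤ s) :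
    a * b * (b * r ^ 2 + a * s ^ 2) / (a + b) ^ 2 - 8 / 27 * (a + b) * (r - s) ^ 2
      ≤ potential (a * r ^ 2) (b * s ^ 2) := by
  have hab : 0 < a + b := add_pos ha hb
  unfold potential
  rcases (by positivity : (0 : ℝ) ≤ a * r ^ 2 + b * s ^ 2).eq_or_lt with h | h
  · have h1 : r = 0 := by
      have : a * r ^ 2 = 0 := by
        nlinarith [mul_nonneg ha.le (sq_nonneg r), mul_nonneg hb.le (sq_nonneg s)]
      simpa [ha.ne'] using this
    have h2 : s = 0 := by
      have : b * s ^ 2 = 0 := by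
        nlinarith [mul_nonneg ha.le (sq_nonneg r), mul_nonneg hb.le (sq_nonneg s)]
      simpa [hb.ne'] using this
    subst h1 h2
    simp
  · have hid : a * b * (b * r ^ 2 + a * s ^ 2) / (a + b) ^ 2
        - a * r ^ 2 * (b * s ^ 2) / (a * r ^ 2 + b * s ^ 2)
        = (a * b) ^ 2 * ((r - s) ^ 2 * (r + s) ^ 2) / ((a + b) ^ 2 * (a * r ^ 2 + b * s ^ 2)) := by
      field_simp
      ring
    have hbound : (a * b) ^ 2 * ((r - s) ^ 2 * (r + s) ^ 2)
          / ((a + b) ^ 2 * (a * r ^ 2 + b * s ^ 2)) ≤ 8 / 27 * (a + b) * (r - s) ^ 2 := by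
      rw [div_le_iff₀ (by positivity)]
      have h1 : (r + s) ^ 2 ≤ 2 * (r ^ 2 + s ^ 2) := by nlinarith [sq_nonneg (r - s)]
      -- `a ^ 2 * b` and `a * b ^ 2` are at most `4 / 27 * (a + b) ^ 3`
      have h2 : 27 * (a ^ 2 * b) ≤ 4 * (a + b) ^ 3 := by
        nlinarith [mul_nonneg (by positivity : 0 ≤ 4 * a + b) (sq_nonneg (a - 2 * b))]
      have h3 : 27 * (a * b ^ 2) ≤ 4 * (a + b) ^ 3 := by
        nlinarith [mul_nonneg (by positivity : 0 ≤ a + 4 * b) (sq_nonneg (b - 2 * a))]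
      have h4 : 27 * ((a * b) ^ 2 * (r ^ 2 + s ^ 2))
          ≤ 4 * (a + b) ^ 3 * (a * r ^ 2 + b * s ^ 2) := by
        have e1 := mul_le_mul_of_nonneg_right h3 (by positivity : 0 ≤ a * r ^ 2)
        have e2 := mul_le_mul_of_nonneg_right h2 (by positivity : 0 ≤ b * s ^ 2)
        nlinarith
      have h5 : (a * b) ^ 2 * (r + s) ^ 2
          ≤ 8 / 27 * (a + b) * ((a + b) ^ 2 * (a * r ^ 2 + b * s ^ 2)) := by
        have e1 := mul_le_mul_of_nonneg_left h1 (sq_nonneg (a * b))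
        nlinarith
      calc (a * b) ^ 2 * ((r - s) ^ 2 * (r + s) ^ 2)
          = (a * b) ^ 2 * (r + s) ^ 2 * (r - s) ^ 2 := by ring
        _ ≤ 8 / 27 * (a + b) * ((a + b) ^ 2 * (a * r ^ 2 + b * s ^ 2)) * (r - s) ^ 2 :=
            mul_le_mul_of_nonneg_right h5 (sq_nonneg _)
        _ = _ := by ring
    linarith

lemma potential_noise_ge {k : ℕ} (hk : k ≠ 0) {a b : ℝ} (ha : 0 ≤ a) (hb : 0 ≤ b) {d : ℤ}
    (hd : |d| ≤ 2) :
    potential a b - 8 / 27 * (a + b) * (4 * (4 * k + 5) / tentMass k)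
      ≤ ∑ c ∈ Finset.Icc (-(2 * k + 2 : ℤ)) (2 * k + 2),
          potential (a * noise k c) (b * noise k (c + d)) := by
  have hS := tentMass_pos hk
  have hpos : 0 ≤ 8 / 27 * (a + b) * (4 * (4 * (k : ℝ) + 5) / tentMass k) := by positivity
  rcases ha.eq_or_lt with rfl | ha'
  · simp only [potential, zero_mul, zero_div, Finset.sum_const_zero]; linarith
  rcases hb.eq_or_lt with rfl | hb'
  · simp only [potential, mul_zero, zero_mul, zero_div, Finset.sum_const_zero]; linarith
  have hterm : ∀ c : ℤ, a * b * (b * noise k c + a * noise k (c + d)) / (a + b) ^ 2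
      - 8 / 27 * (a + b) * ((tent k c - tent k (c + d)) ^ 2 / tentMass k)
      ≤ potential (a * noise k c) (b * noise k (c + d)) := by
    intro c
    have hsq := Real.sq_sqrt hS.le
    have h := potential_mul_sq_ge ha' hb'
      (div_nonneg (tent_nonneg k c) (Real.sqrt_nonneg (tentMass k)))
      (div_nonneg (tent_nonneg k (c + d)) (Real.sqrt_nonneg (tentMass k)))
    rw [← sub_div, div_pow, div_pow, div_pow, hsq] at h
    exact h
  refine le_trans ?_ (Finset.sum_le_sum fun c _ => hterm c)
  rw [Finset.sum_sub_distrib, ← Finset.mul_sum, ← Finset.sum_div, ← Finset.sum_div,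
    ← Finset.mul_sum, Finset.sum_add_distrib, ← Finset.mul_sum, ← Finset.mul_sum]
  have h1 : ∑ c ∈ Finset.Icc (-(2 * k + 2 : ℤ)) (2 * k + 2), noise k (c + d) = 1 := by
    rw [← sum_eq_sum_shift (fun c hc => noise_eq_zero hc) hd, sum_noise hk]
  have h0 : ∑ c ∈ Finset.Icc (-(2 * k + 2 : ℤ)) (2 * k + 2), noise k c = 1 := by
    rw [← sum_noise hk, sum_eq_sum_shift (fun c hc => noise_eq_zero hc) (d := 0) (by simp)]
    simp
  rw [h0, h1]
  have h2 : a * b * (b * 1 + a * 1) / (a + b) ^ 2 = potential a b := by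
    unfold potential
    field_simp
    ring
  rw [h2]
  have := sum_sq_tent_sub_le k hd
  gcongr

/-- One step of the backward induction: if the two hypotheses are matched along `c ↦ c + d`, then
averaging over the noise costs the potential at most the stated multiple of `a + b`, and nothing
when there is no shift. -/
lemma le_sum_noise_mul {k : ℕ} (hk : k ≠ 0) {H₀ H₁ : ℤ → ℝ} {K Q : ℝ} (hK : 0 ≤ K) {d : ℤ}
    (hd : |d| ≤ 2)
    (hH : ∀ c : ℤ, ∀ a b : ℝ, 0 ≤ a → 0 ≤ b →
      K * potential a b + (a + b) * Q ≤ a * H₀ c + b * H₁ (c + d))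
    {a b : ℝ} (ha : 0 ≤ a) (hb : 0 ≤ b) :
    K * potential a b
        + (a + b) * (Q - if d = 0 then 0 else K * (8 / 27 * (4 * (4 * k + 5) / tentMass k)))
      ≤ a * ∑ c ∈ Finset.Icc (-(2 * k : ℤ)) (2 * k), noise k c * H₀ c
        + b * ∑ c ∈ Finset.Icc (-(2 * k : ℤ)) (2 * k), noise k c * H₁ c := by
  split_ifs with hd0
  · subst hd0
    rw [sub_zero]
    rw [Finset.mul_sum, Finset.mul_sum, ← Finset.sum_add_distrib]
    have h1 : ∑ c ∈ Finset.Icc (-(2 * k : ℤ)) (2 * k),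
        noise k c * (K * potential a b + (a + b) * Q) = K * potential a b + (a + b) * Q := by
      rw [← Finset.sum_mul, sum_noise hk, one_mul]
    rw [← h1]
    refine Finset.sum_le_sum fun c _ => ?_
    have h2 := mul_le_mul_of_nonneg_left (hH c a b ha hb) (noise_nonneg k c)
    rw [add_zero] at h2
    linarith
  · rw [sum_eq_sum_shift (F := fun c => noise k c * H₀ c) (d := 0)
        (fun c hc => by rw [noise_eq_zero hc, zero_mul]) (by simp),
      sum_eq_sum_shift (F := fun c => noise k c * H₁ c) (d := d)
        (fun c hc => by rw [noise_eq_zero hc, zero_mul]) hd,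
      Finset.mul_sum, Finset.mul_sum, ← Finset.sum_add_distrib]
    have h1 : ∑ c ∈ Finset.Icc (-(2 * k + 2 : ℤ)) (2 * k + 2), noise k (c + d) = 1 := by
      rw [← sum_eq_sum_shift (fun c hc => noise_eq_zero hc) hd, sum_noise hk]
    have h0 : ∑ c ∈ Finset.Icc (-(2 * k + 2 : ℤ)) (2 * k + 2), noise k c = 1 := by
      rw [← sum_noise hk, sum_eq_sum_shift (fun c hc => noise_eq_zero hc) (d := 0) (by simp)]
      simp
    have hG := mul_le_mul_of_nonneg_left (potential_noise_ge hk ha hb hd) hK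
    calc _ ≤ ∑ c ∈ Finset.Icc (-(2 * k + 2 : ℤ)) (2 * k + 2),
          (K * potential (a * noise k c) (b * noise k (c + d))
            + (a * noise k c + b * noise k (c + d)) * Q) := by
          rw [Finset.sum_add_distrib, ← Finset.mul_sum, ← Finset.sum_mul, Finset.sum_add_distrib,
            ← Finset.mul_sum, ← Finset.mul_sum, h0, h1]
          linarith
      _ ≤ _ := by
          refine Finset.sum_le_sum fun c _ => ?_
          have h2 := hH c _ _ (mul_nonneg ha (noise_nonneg k c))
            (mul_nonneg hb (noise_nonneg k (c + d)))
          rw [add_zero]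
          linarith

/-! ### Averaging over the increments -/

/-- The expectation of `Φ` when the increments at the `n` times `t, …, t + n - 1` are independent
with law `noise k` and the other increments are those of `z`. -/
def noiseAvg (k : ℕ) (Φ : (ℕ → ℤ) → ℝ) : ℕ → ℕ → (ℕ → ℤ) → ℝ
  | 0, _, z => Φ z
  | n + 1, t, z => ∑ c ∈ Finset.Icc (-(2 * k : ℤ)) (2 * k),
      noise k c * noiseAvg k Φ n (t + 1) (Function.update z t c)

lemma noiseAvg_le {k : ℕ} (hk : k ≠ 0) {Φ : (ℕ → ℤ) → ℝ} {C : ℝ}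
    (hΦ : ∀ z : ℕ → ℤ, (∀ i, |z i| ≤ (2 * k : ℕ)) → Φ z ≤ C) (n : ℕ) :
    ∀ (t : ℕ) (z : ℕ → ℤ), (∀ i, |z i| ≤ (2 * k : ℕ)) → noiseAvg k Φ n t z ≤ C := by
  induction n with
  | zero => exact fun t z hz => hΦ z hz
  | succ n ih =>
    intro t z hz
    rw [noiseAvg]
    calc _ ≤ ∑ c ∈ Finset.Icc (-(2 * k : ℤ)) (2 * k), noise k c * C := by
          refine Finset.sum_le_sum fun c hc =>
            mul_le_mul_of_nonneg_left (ih _ _ ?_) (noise_nonneg k c)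
          intro i
          rcases eq_or_ne i t with rfl | hi
          · rw [Function.update_self, abs_le]
            rw [Finset.mem_Icc] at hc
            push_cast
            exact hc
          · rw [Function.update_of_ne hi]; exact hz i
      _ = C := by rw [← Finset.sum_mul, sum_noise hk, one_mul]

lemma integrable_noiseAvg {Ω : Type*} [MeasurableSpace Ω] {μ : Measure Ω} (k : ℕ)
    {Φ : (ℕ → ℤ) → Ω → ℝ} (hΦ : ∀ z, Integrable (Φ z) μ) (n : ℕ) :
    ∀ (t : ℕ) (z : ℕ → ℤ), Integrable (fun ω => noiseAvg k (fun z => Φ z ω) n t z) μ := by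
  induction n with
  | zero => exact fun t z => hΦ z
  | succ n ih =>
    intro t z
    simp only [noiseAvg]
    exact integrable_finsetSum _ fun c _ => (ih _ _).const_mul _

lemma noiseAvg_integral {Ω : Type*} [MeasurableSpace Ω] {μ : Measure Ω} (k : ℕ)
    {Φ : (ℕ → ℤ) → Ω → ℝ} (hΦ : ∀ z, Integrable (Φ z) μ) (n : ℕ) :
    ∀ (t : ℕ) (z : ℕ → ℤ), noiseAvg k (fun z => ∫ ω, Φ z ω ∂μ) n t z
      = ∫ ω, noiseAvg k (fun z => Φ z ω) n t z ∂μ := by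
  induction n with
  | zero => exact fun t z => rfl
  | succ n ih =>
    intro t z
    simp only [noiseAvg]
    rw [integral_finsetSum _ fun c _ => (integrable_noiseAvg k hΦ n _ _).const_mul _]
    simp only [ih, integral_const_mul]

/-! ### The played actions and their dependence on the losses -/

section Play

variable {A Ω : Type*} [MeasurableSpace Ω]

lemma play_castSucc (π : RandomizedPlayer A Ω) (f : LossSequence A) (ω : Ω) (n : ℕ) (i : Fin n) :
    play π f ω (n + 1) i.castSucc = play π f ω n i := by
  rw [play, Fin.snoc_castSucc]

lemma play_apply (π : RandomizedPlayer A Ω) (f : LossSequence A) (ω : Ω) {n : ℕ} (i : Fin n) :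
    play π f ω n i = play π f ω (i + 1) (Fin.last i) := by
  induction n with
  | zero => exact i.elim0
  | succ n ih =>
    refine Fin.lastCases ?_ (fun j => ?_) i
    · rfl
    · rw [play_castSucc]
      exact ih j

lemma fullInfoFeedback_play (π : RandomizedPlayer A Ω) (f f' : LossSequence A) (ω : Ω) {t : ℕ}
    (s : Fin t) (a : A) :
    fullInfoFeedback f (play π f' ω t) s a
      = f s (Fin.snoc (α := fun _ => A) (play π f' ω s) a) := by
  unfold fullInfoFeedback
  congr 2
  funext i
  rw [play_apply, play_apply π f' ω i]
  rfl

/-- If two loss sequences agree on the feedback that the player gets from the first before round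
`t`, then the actions up to round `t` are the same against both. -/
lemma play_congr (π : RandomizedPlayer A Ω) {f f' : LossSequence A} (ω : Ω) {t : ℕ}
    (h : ∀ s < t, ∀ a, f' s (Fin.snoc (α := fun _ => A) (play π f ω s) a)
      = f s (Fin.snoc (α := fun _ => A) (play π f ω s) a)) :
    ∀ t' ≤ t + 1, play π f' ω t' = play π f ω t' := by
  intro t'
  induction t' with
  | zero => intro _; rfl
  | succ n ih =>
    intro hn
    have h1 := ih (by omega)
    have h2 : fullInfoFeedback f' (play π f ω n) = fullInfoFeedback f (play π f ω n) := by
      funext s a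
      rw [fullInfoFeedback_play, fullInfoFeedback_play]
      exact h s (by omega) a
    rw [play, play, h1, h2]

lemma measurableSet_play_eq (π : RandomizedPlayer A Ω) (f : LossSequence A) (n : ℕ) :
    ∀ x : Fin n → A, MeasurableSet {ω | play π f ω n = x} := by
  induction n with
  | zero =>
    intro x
    have : {ω | play π f ω 0 = x} = Set.univ := by
      ext ω; simp [Subsingleton.elim (play π f ω 0) x]
    rw [this]
    exact MeasurableSet.univ
  | succ n ih =>
    intro x
    have : {ω | play π f ω (n + 1) = x} = {ω | play π f ω n = Fin.init (α := fun _ => A) x} ∩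
        {ω | π.act n ω (Fin.init (α := fun _ => A) x)
          (fullInfoFeedback f (Fin.init (α := fun _ => A) x)) = x (Fin.last n)} := by
      ext ω
      simp only [Set.mem_ofPred_eq, Set.mem_inter_iff]
      constructor
      · intro h
        have h1 : play π f ω n = Fin.init (α := fun _ => A) x := by
          rw [← h]; funext i; exact (play_castSucc π f ω n i).symm
        refine ⟨h1, ?_⟩
        rw [← h1, ← h, play, Fin.snoc_last]
      · rintro ⟨h1, h2⟩
        rw [play, h1, h2, Fin.snoc_init_self]
    rw [this]
    exact (ih _).inter (π.measurableSet_act _ _ _ _)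

lemma integrable_policyRegret [Finite A] (μ : Measure Ω) [IsFiniteMeasure μ]
    (π : RandomizedPlayer A Ω) (f : LossSequence A) (n : ℕ) :
    Integrable (policyRegret π f n) μ := by
  refine Integrable.sub (integrable_finsetSum _ fun t _ => ?_) (integrable_const _)
  let _ : MeasurableSpace (Fin (t + 1) → A) := ⊤
  have hm : Measurable fun ω => play π f ω (t + 1) :=
    measurable_to_countable' fun x => measurableSet_play_eq π f (t + 1) x
  exact (Integrable.of_finite (f := f t)).comp_measurable hm

end Play

/-! ### The adversary -/

section Adversary

variable {A Ω : Type*} [MeasurableSpace Ω]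

/-- The loss of an arm relative to the walk under the hypothesis `θ`, in units of the gap. The arm
`false` is the reference, and the hypothesis names the better arm. -/
def offset (θ b : Bool) : ℤ := if b then (if θ then -1 else 1) else 0

/-- The loss sequence with arms `χ a`, gap `δ`, better arm `θ` and walk increments `z`. The loss of
a round is the walk plus the offset of the *previous* arm, plus `1 / 2` for a change of arm. It is
the previous arm that enters, so the feedback of a round shows the offset of one arm only. -/
def walkLoss (χ : A → Bool) (δ : ℝ) (T : ℕ) (θ : Bool) (z : ℕ → ℤ) : LossSequence A
  | 0, _ => 0
  | t + 1, x =>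
    if t + 1 ≤ T then
      1 / 4 + δ * ((walk z (t + 1) + offset θ (χ (x (Fin.last t).castSucc)) : ℤ) : ℝ)
        + if χ (x (Fin.last t).castSucc) = χ (x (Fin.last (t + 1))) then 0 else 1 / 2
    else 0

/-- The arm on which the loss of round `t` depends, that of round `t - 1`; at the root `t = 0` of
the tree it is the reference arm. -/
def lagArm (π : RandomizedPlayer A Ω) (f : LossSequence A) (ω : Ω) (χ : A → Bool) : ℕ → Bool
  | 0 => false
  | t + 1 => χ (play π f ω (t + 1) (Fin.last t))

lemma lagArm_congr {π : RandomizedPlayer A Ω} {f f' : LossSequence A} {ω : Ω} (χ : A → Bool)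
    {t : ℕ} (h : play π f' ω t = play π f ω t) : lagArm π f' ω χ t = lagArm π f ω χ t := by
  cases t with
  | zero => rfl
  | succ t => rw [lagArm, lagArm, h]

lemma abs_offset_le (θ b : Bool) : |offset θ b| ≤ 1 := by
  revert θ b; decide

lemma walkLoss_unitBounded (χ : A → Bool) {δ : ℝ} (hδ : 0 ≤ δ) {T m k : ℕ} (hT : T < 2 ^ k)
    (hsmall : δ * (m * k + 1) ≤ 1 / 4) (θ : Bool) {z : ℕ → ℤ} (hz : ∀ i, |z i| ≤ m) :
    (walkLoss χ δ T θ z).UnitBounded := by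
  intro t x
  cases t with
  | zero => simp [walkLoss]
  | succ t =>
    rw [walkLoss]
    split_ifs with ht h
    all_goals try exact ⟨le_rfl, zero_le_one⟩
    all_goals
      have h1 : |walk z (t + 1) + offset θ (χ (x (Fin.last t).castSucc))| ≤ m * k + 1 :=
        (abs_add_le _ _).trans (add_le_add (abs_walk_le hz (by omega)) (abs_offset_le _ _))
      have h2 : |((walk z (t + 1) + offset θ (χ (x (Fin.last t).castSucc)) : ℤ) : ℝ)|
          ≤ (m * k + 1 : ℝ) := by exact_mod_cast h1
      generalize ((walk z (t + 1) + offset θ (χ (x (Fin.last t).castSucc)) : ℤ) : ℝ) = v at h2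
      have h3 : |δ * v| ≤ 1 / 4 := by
        rw [abs_mul, abs_of_nonneg hδ]
        exact (mul_le_mul_of_nonneg_left h2 hδ).trans hsmall
      have h4 := abs_le.1 h3
      constructor <;> linarith [h4.1, h4.2]

lemma walkLoss_hasMemory (χ : A → Bool) (δ : ℝ) (T : ℕ) (θ : Bool) (z : ℕ → ℤ) :
    (walkLoss χ δ T θ z).HasMemory 1 := by
  intro t x x' h
  cases t with
  | zero => rfl
  | succ t =>
    rw [walkLoss, walkLoss, h (Fin.last t).castSucc (by simp), h (Fin.last (t + 1)) (by simp)]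

/-- The losses shown in a round are determined by the walk plus the offset of the lagged arm. -/
lemma walkLoss_snoc (π : RandomizedPlayer A Ω) (f : LossSequence A) (ω : Ω) (χ : A → Bool) (δ : ℝ)
    (T : ℕ) (θ : Bool) (z : ℕ → ℤ) (t : ℕ) (a : A) :
    walkLoss χ δ T θ z (t + 1) (Fin.snoc (α := fun _ => A) (play π f ω (t + 1)) a)
      = if t + 1 ≤ T then
          1 / 4 + δ * ((walk z (t + 1) + offset θ (lagArm π f ω χ (t + 1)) : ℤ) : ℝ)
            + if lagArm π f ω χ (t + 1) = χ a then 0 else 1 / 2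
        else 0 := by
  rw [walkLoss, Fin.snoc_castSucc, Fin.snoc_last]
  rfl

lemma play_update (π : RandomizedPlayer A Ω) (ω : Ω) (χ : A → Bool) (δ : ℝ) (T : ℕ) (θ : Bool)
    (z : ℕ → ℤ) (t : ℕ) (c : ℤ) {s : ℕ} (hs : s ≤ t + 1) :
    play π (walkLoss χ δ T θ (Function.update z t c)) ω s = play π (walkLoss χ δ T θ z) ω s := by
  refine play_congr π ω (t := t) (fun i hi a => ?_) s hs
  cases i with
  | zero => rfl
  | succ i => rw [walkLoss_snoc, walkLoss_snoc, walk_update_of_lt z hi]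

/-- The increments `z₀` under the hypothesis `false` and `z₁` under the hypothesis `true` lead to
the same observations before time `t`. The arms are those played in the first case; by
`Matched.play_eq` they are also those played in the second. -/
def Matched (π : RandomizedPlayer A Ω) (ω : Ω) (χ : A → Bool) (δ : ℝ) (T t : ℕ)
    (z₀ z₁ : ℕ → ℤ) : Prop :=
  ∀ i < t, walk z₀ i + offset false (lagArm π (walkLoss χ δ T false z₀) ω χ i)
    = walk z₁ i + offset true (lagArm π (walkLoss χ δ T false z₀) ω χ i)

lemma Matched.play_eq {π : RandomizedPlayer A Ω} {ω : Ω} {χ : A → Bool} {δ : ℝ} {T t : ℕ}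
    {z₀ z₁ : ℕ → ℤ} (h : Matched π ω χ δ T t z₀ z₁) {s : ℕ} (hs : s ≤ t + 1) :
    play π (walkLoss χ δ T true z₁) ω s = play π (walkLoss χ δ T false z₀) ω s := by
  refine play_congr π ω (t := t) (fun i hi a => ?_) s hs
  cases i with
  | zero => rfl
  | succ i => rw [walkLoss_snoc, walkLoss_snoc, h _ hi]

/-- The amount by which the increments under the two hypotheses must differ for equal observations,
when the lagged arm is `b` and that at the parent time is `b'`. -/
def armShift (b b' : Bool) : ℤ :=
  (offset false b - offset false b') - (offset true b - offset true b')

lemma abs_armShift_le (b b' : Bool) : |armShift b b'| ≤ 2 := by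
  revert b b'; decide

lemma armShift_eq_zero_iff (b b' : Bool) : armShift b b' = 0 ↔ b = b' := by
  revert b b'; decide

lemma Matched.update {π : RandomizedPlayer A Ω} {ω : Ω} {χ : A → Bool} {δ : ℝ} {T t : ℕ}
    {z₀ z₁ : ℕ → ℤ} (h : Matched π ω χ δ T t z₀ z₁) (ht : t ≠ 0) (c : ℤ) :
    Matched π ω χ δ T (t + 1) (Function.update z₀ t c)
      (Function.update z₁ t (c + armShift (lagArm π (walkLoss χ δ T false z₀) ω χ t)
        (lagArm π (walkLoss χ δ T false z₀) ω χ (parent t)))) := by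
  intro i hi
  rw [lagArm_congr χ (play_update π ω χ δ T false z₀ t c (by omega : i ≤ t + 1))]
  rcases (Nat.lt_succ_iff.1 hi).eq_or_lt with rfl | hi'
  · rw [walk_update_self z₀ ht, walk_update_self z₁ ht]
    have := h _ (parent_lt ht)
    unfold armShift
    linarith
  · rw [walk_update_of_lt z₀ hi', walk_update_of_lt z₁ hi']
    exact h i hi'

/-- The regret is at least the gap times the number of rounds with the worse lagged arm, plus
`1 / 2` for each change of arm. -/
lemma le_policyRegret [Finite A] (π : RandomizedPlayer A Ω) (ω : Ω) {χ : A → Bool}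
    (hχ : Function.Surjective χ) (δ : ℝ) (T : ℕ) (θ : Bool) (z : ℕ → ℤ) :
    ∑ t ∈ Finset.range T,
        ((if lagArm π (walkLoss χ δ T θ z) ω χ (t + 1) = θ then 0 else δ)
          + if lagArm π (walkLoss χ δ T θ z) ω χ (t + 1)
              = lagArm π (walkLoss χ δ T θ z) ω χ (t + 2) then 0 else 1 / 2)
      ≤ policyRegret π (walkLoss χ δ T θ z) (T + 1) ω := by
  obtain ⟨a, ha⟩ := hχ θ
  have hinf : ⨅ a : A, ∑ t ∈ Finset.range (T + 1), walkLoss χ δ T θ z t (fun _ => a)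
      ≤ ∑ t ∈ Finset.range (T + 1), walkLoss χ δ T θ z t (fun _ => a) :=
    ciInf_le (Set.finite_range _).bddBelow a
  unfold policyRegret
  refine le_trans ?_ (sub_le_sub_left hinf _)
  rw [← Finset.sum_sub_distrib, Finset.sum_range_succ']
  have h0 : walkLoss χ δ T θ z 0 (play π (walkLoss χ δ T θ z) ω (0 + 1))
      - walkLoss χ δ T θ z 0 (fun _ => a) = 0 := sub_self 0
  rw [h0, add_zero]
  refine Finset.sum_le_sum fun t ht => ?_
  rw [Finset.mem_range] at ht
  have h1 : play π (walkLoss χ δ T θ z) ω (t + 1 + 1)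
      = Fin.snoc (α := fun _ => A) (play π (walkLoss χ δ T θ z) ω (t + 1))
        (play π (walkLoss χ δ T θ z) ω (t + 1 + 1) (Fin.last (t + 1))) := by
    have hinit : Fin.init (α := fun _ => A) (play π (walkLoss χ δ T θ z) ω (t + 1 + 1))
        = play π (walkLoss χ δ T θ z) ω (t + 1) := funext fun i => play_castSucc _ _ _ _ i
    rw [← hinit, Fin.snoc_init_self]
  have hT : t + 1 ≤ T := ht
  rw [h1, walkLoss_snoc, walkLoss, if_pos hT, if_pos hT, if_pos (rfl : χ a = χ a), ha]
  have h2 : χ (play π (walkLoss χ δ T θ z) ω (t + 1 + 1) (Fin.last (t + 1)))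
      = lagArm π (walkLoss χ δ T θ z) ω χ (t + 2) := rfl
  rw [h2]
  have h3 : (if lagArm π (walkLoss χ δ T θ z) ω χ (t + 1) = θ then 0 else δ)
      = δ * ((offset θ (lagArm π (walkLoss χ δ T θ z) ω χ (t + 1)) : ℤ) : ℝ)
        - δ * ((offset θ θ : ℤ) : ℝ) := by
    generalize lagArm π (walkLoss χ δ T θ z) ω χ (t + 1) = b
    cases θ <;> cases b <;> simp [offset]
  rw [h3]
  push_cast
  linarith

/-! ### The backward induction -/

/-- The number of times before `t` at which the lagged arm differs from that at the parent; these
are the only times at which the observations discriminate between the hypotheses. -/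
def shiftCount (x : ℕ → Bool) (t : ℕ) : ℕ :=
  ((Finset.Ico 1 t).filter fun i => x i ≠ x (parent i)).card

lemma shiftCount_succ (x : ℕ → Bool) {t : ℕ} (ht : t ≠ 0) :
    (shiftCount x (t + 1) : ℝ) = shiftCount x t + if x t = x (parent t) then 0 else 1 := by
  unfold shiftCount
  rw [← Finset.insert_Ico_right_eq_Ico_add_one (by omega), Finset.filter_insert]
  by_cases h : x t = x (parent t)
  · simp [h]
  · rw [if_pos h, if_neg h, Finset.card_insert_of_notMem (by simp)]
    push_cast
    rfl

lemma shiftCount_congr {x x' : ℕ → Bool} {t : ℕ} (h : ∀ i < t, x i = x' i) :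
    shiftCount x t = shiftCount x' t := by
  unfold shiftCount
  congr 1
  refine Finset.filter_congr fun i hi => ?_
  rw [Finset.mem_Ico] at hi
  rw [h i hi.2, h _ ((parent_lt (by omega)).trans hi.2)]

/-- The arm `x 0` at the root is not chosen by the player, hence the term `1` for the possible
change at time `1`. -/
lemma shiftCount_le (x : ℕ → Bool) {T k : ℕ} (hT : T < 2 ^ k) :
    (shiftCount x (T + 1) : ℝ)
      ≤ k * (1 + ∑ t ∈ Finset.range T, if x (t + 1) = x (t + 2) then (0 : ℝ) else 1) := by
  have h1 : shiftCount x (T + 1)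
      ≤ ((Finset.Icc 1 T).filter fun s => x s ≠ x (s - 1)).card * k :=
    card_ne_parent_le x hT
  have h2 : (((Finset.Icc 1 T).filter fun s => x s ≠ x (s - 1)).card : ℝ)
      = ∑ t ∈ Finset.range T, if x t = x (t + 1) then (0 : ℝ) else 1 := by
    rw [Finset.card_filter, Nat.cast_sum, Finset.range_eq_Ico,
      ← Finset.sum_Ico_add_right_sub_eq (f := fun t => if x t = x (t + 1) then (0 : ℝ) else 1)
        0 T 1]
    refine Finset.sum_congr (by ext; simp) fun s hs => ?_
    rw [Finset.mem_Ico] at hs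
    rw [Nat.sub_add_cancel (by omega)]
    by_cases h : x s = x (s - 1)
    · simp [h]
    · simp [h, Ne.symm h]
  have h3 : ∑ t ∈ Finset.range T, (if x t = x (t + 1) then (0 : ℝ) else 1)
      ≤ 1 + ∑ t ∈ Finset.range T, if x (t + 1) = x (t + 2) then (0 : ℝ) else 1 := by
    have e1 := Finset.sum_range_succ (fun t => if x t = x (t + 1) then (0 : ℝ) else 1) T
    have e2 := Finset.sum_range_succ' (fun t => if x t = x (t + 1) then (0 : ℝ) else 1) T
    have e3 : (0 : ℝ) ≤ if x T = x (T + 1) then (0 : ℝ) else 1 := by split_ifs <;> norm_num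
    have e4 : (if x 0 = x (0 + 1) then (0 : ℝ) else 1) ≤ 1 := by split_ifs <;> norm_num
    simp only [add_assoc, Nat.reduceAdd] at e1 e2 e3 e4 ⊢
    linarith
  have h4 : (shiftCount x (T + 1) : ℝ)
      ≤ ((Finset.Icc 1 T).filter fun s => x s ≠ x (s - 1)).card * k := by exact_mod_cast h1
  rw [h2] at h4
  have := mul_le_mul_of_nonneg_right h3 (Nat.cast_nonneg k : (0 : ℝ) ≤ k)
  linarith

/-- The bound on the value of the game, from the leaves up: `a` and `b` are the likelihoods of the
observations before time `t` under the two hypotheses. A time with a shift lowers the potential by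
at most `η * (a + b)`, which is paid for by the cost of the changes of arm. -/
lemma le_noiseAvg_policyRegret [Finite A] (π : RandomizedPlayer A Ω) (ω : Ω) {χ : A → Bool}
    (hχ : Function.Surjective χ) {δ : ℝ} (hδ : 0 ≤ δ) {T D k : ℕ} (hT : T < 2 ^ D) (hk : k ≠ 0)
    {η : ℝ} (hη : η = δ * T * (8 / 27 * (4 * (4 * k + 5) / tentMass k)))
    (hηD : η * D ≤ 1 / 2) (n : ℕ) :
    ∀ (t : ℕ) (z₀ z₁ : ℕ → ℤ) (a b : ℝ), t ≠ 0 → t + n = T + 1 →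
      Matched π ω χ δ T t z₀ z₁ → 0 ≤ a → 0 ≤ b →
      δ * T * potential a b
          + (a + b) * (η * shiftCount (lagArm π (walkLoss χ δ T false z₀) ω χ) t - η * D)
        ≤ a * noiseAvg k (fun z => policyRegret π (walkLoss χ δ T false z) (T + 1) ω) n t z₀
          + b * noiseAvg k (fun z => policyRegret π (walkLoss χ δ T true z) (T + 1) ω) n t z₁ := by
  have hη0 : 0 ≤ η := by
    have := tentMass_pos hk
    rw [hη]; positivity
  induction n with
  | zero =>
    intro t z₀ z₁ a b _ htn hM ha hb
    obtain rfl : t = T + 1 := by omega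
    rw [noiseAvg, noiseAvg]
    have h0 := mul_le_mul_of_nonneg_left (le_policyRegret π ω hχ δ T false z₀) ha
    have h1 := mul_le_mul_of_nonneg_left (le_policyRegret π ω hχ δ T true z₁) hb
    refine le_trans ?_ (add_le_add h0 h1)
    have hx : ∀ i ≤ T + 2, lagArm π (walkLoss χ δ T true z₁) ω χ i
        = lagArm π (walkLoss χ δ T false z₀) ω χ i :=
      fun i hi => lagArm_congr χ (hM.play_eq hi)
    have hsum : ∑ t ∈ Finset.range T,
        ((if lagArm π (walkLoss χ δ T true z₁) ω χ (t + 1) = true then 0 else δ)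
          + if lagArm π (walkLoss χ δ T true z₁) ω χ (t + 1)
              = lagArm π (walkLoss χ δ T true z₁) ω χ (t + 2) then 0 else 1 / 2)
        = ∑ t ∈ Finset.range T,
        ((if lagArm π (walkLoss χ δ T false z₀) ω χ (t + 1) = true then 0 else δ)
          + if lagArm π (walkLoss χ δ T false z₀) ω χ (t + 1)
              = lagArm π (walkLoss χ δ T false z₀) ω χ (t + 2) then 0 else 1 / 2) := by
      refine Finset.sum_congr rfl fun t ht => ?_
      rw [Finset.mem_range] at ht
      rw [hx (t + 1) (by omega), hx (t + 2) (by omega)]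
    rw [hsum]
    generalize lagArm π (walkLoss χ δ T false z₀) ω χ = x
    have hS := mul_le_mul_of_nonneg_left (shiftCount_le x hT) hη0
    have hN0 : 0 ≤ ∑ t ∈ Finset.range T, if x (t + 1) = x (t + 2) then (0 : ℝ) else 1 :=
      Finset.sum_nonneg fun t _ => by split_ifs <;> norm_num
    have hN : η * shiftCount x (T + 1) - η * D
        ≤ 1 / 2 * ∑ t ∈ Finset.range T, if x (t + 1) = x (t + 2) then (0 : ℝ) else 1 := by
      have := mul_le_mul_of_nonneg_right hηD hN0
      linarith
    refine le_trans (add_le_add_right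
      (mul_le_mul_of_nonneg_left hN (add_nonneg ha hb)) _) ?_
    have hconst : δ * T * potential a b = ∑ _t ∈ Finset.range T, δ * potential a b := by
      rw [Finset.sum_const, Finset.card_range, nsmul_eq_mul]; ring
    rw [hconst, Finset.mul_sum, Finset.mul_sum, Finset.mul_sum, Finset.mul_sum,
      ← Finset.sum_add_distrib, ← Finset.sum_add_distrib]
    refine Finset.sum_le_sum fun t _ => ?_
    have hl := mul_le_mul_of_nonneg_left (potential_le_left ha hb) hδ
    have hr := mul_le_mul_of_nonneg_left (potential_le_right ha hb) hδ
    cases x (t + 1) <;> cases x (t + 2) <;> simp <;> linarith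
  | succ n ih =>
    intro t z₀ z₁ a b ht htn hM ha hb
    rw [noiseAvg, noiseAvg]
    set x := lagArm π (walkLoss χ δ T false z₀) ω χ
    have hstep := le_sum_noise_mul hk (K := δ * T) (Q := η * shiftCount x (t + 1) - η * D)
      (d := armShift (x t) (x (parent t)))
      (H₀ := fun c => noiseAvg k (fun z => policyRegret π (walkLoss χ δ T false z) (T + 1) ω)
        n (t + 1) (Function.update z₀ t c))
      (H₁ := fun c => noiseAvg k (fun z => policyRegret π (walkLoss χ δ T true z) (T + 1) ω)
        n (t + 1) (Function.update z₁ t c))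
      (by positivity) (abs_armShift_le _ _) (fun c a b ha hb => by
        have h := ih (t + 1) _ _ a b (by omega) (by omega) (hM.update ht c) ha hb
        rwa [shiftCount_congr (x' := x) fun i hi =>
          lagArm_congr χ (play_update π ω χ δ T false z₀ t c (by omega))] at h) ha hb
    refine le_trans (le_of_eq ?_) hstep
    rw [shiftCount_succ x ht, ← hη]
    simp only [armShift_eq_zero_iff]
    split_ifs <;> ring

end Adversary

/-! ### The choice of the parameters -/

/-- With `q = T ^ (1 / 3)`, the gap is `δ = 1 / (64 * q * log₂ T)` and the noise has width of order
`q`, measured in units of `δ`. The walk, of depth about `log₂ T`, then stays in a bounded range, and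
the cost `η` of a shift is so small that `η` times the cut width is paid for by a change of arm. -/
lemma parameter_bounds {T : ℕ} (hT : 10 < T) : ∃ (δ : ℝ) (k : ℕ), 0 ≤ δ ∧ k ≠ 0 ∧
    δ * ((2 * k : ℕ) * (Nat.log 2 T + 1 : ℕ) + 1) ≤ 1 / 4 ∧
    δ * T * (8 / 27 * (4 * (4 * k + 5) / tentMass k)) * (Nat.log 2 T + 1 : ℕ) ≤ 1 / 2 ∧
    (T : ℝ) ^ (2 / 3 : ℝ) / (500 * Real.logb 2 T) < δ * T / 4
      - δ * T * (8 / 27 * (4 * (4 * k + 5) / tentMass k)) * (Nat.log 2 T + 1 : ℕ) := by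
  have hTR : (11 : ℝ) ≤ T := by exact_mod_cast hT
  set q : ℝ := (T : ℝ) ^ (1 / 3 : ℝ) with hqdef
  have hq0 : 0 < q := Real.rpow_pos_of_pos (by linarith) _
  have hq3 : q ^ 3 = T := by
    rw [hqdef, ← Real.rpow_natCast, ← Real.rpow_mul (by linarith)]; norm_num
  have hq2 : (T : ℝ) ^ (2 / 3 : ℝ) = q ^ 2 := by
    rw [hqdef, ← Real.rpow_natCast, ← Real.rpow_mul (by linarith)]; norm_num
  have hq : 11 / 5 ≤ q := by
    by_contra! h
    have := pow_lt_pow_left₀ h hq0.le (by norm_num : 3 ≠ 0)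
    rw [hq3] at this
    norm_num at this
    linarith
  set L : ℝ := Real.logb 2 T with hLdef
  have hlog2 : 0.6931 < Real.log 2 := lt_trans (by norm_num) Real.log_two_gt_d9
  have hLlog : L * Real.log 2 = Real.log T := by
    rw [hLdef, Real.logb]; field_simp
  -- `2 ^ 10 ≤ 11 ^ 3`
  have hL : 10 / 3 ≤ L := by
    have h1 : Real.log ((2 : ℝ) ^ 10) ≤ Real.log ((T : ℝ) ^ 3) := by
      refine Real.log_le_log (by norm_num) (le_trans (by norm_num) (pow_le_pow_left₀ ?_ hTR 3))
      norm_num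
    rw [Real.log_pow, Real.log_pow, ← hLlog] at h1
    push_cast at h1
    by_contra! h
    nlinarith
  have hD1 : ((Nat.log 2 T + 1 : ℕ) : ℝ) ≤ L + 1 := by
    push_cast
    have := Real.natLog_le_logb T 2
    push_cast at this
    linarith
  have hD2 : ((Nat.log 2 T + 1 : ℕ) : ℝ) ≤ q ^ 2 := by
    have h1 : Real.log (q ^ 2 / 4) ≤ q ^ 2 / 4 - 1 := Real.log_le_sub_one_of_pos (by positivity)
    have h2 : Real.log (q ^ 2 / 4) = 2 * Real.log q - 2 * Real.log 2 := by
      rw [Real.log_div (by positivity) (by norm_num), show (4 : ℝ) = 2 ^ 2 by norm_num,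
        Real.log_pow, Real.log_pow]
      push_cast; ring
    have h3 : L * Real.log 2 = 3 * Real.log q := by
      rw [hLlog, ← hq3, Real.log_pow]; push_cast; ring
    have h4 : (L - 3) * Real.log 2 ≤ 3 / 2 * (q ^ 2 / 4 - 1) := by linarith
    have h5 : (L - 3) * 0.6931 ≤ 3 / 2 * (q ^ 2 / 4 - 1) :=
      le_trans (mul_le_mul_of_nonneg_left hlog2.le (by linarith)) h4
    nlinarith
  have hD0 : (0 : ℝ) ≤ (Nat.log 2 T + 1 : ℕ) := Nat.cast_nonneg _
  set D : ℝ := ((Nat.log 2 T + 1 : ℕ) : ℝ) with hDdef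
  have hk1 : 5 * q ≤ ⌈5 * q⌉₊ := Nat.le_ceil _
  have hk2 : (⌈5 * q⌉₊ : ℝ) ≤ 5 * q + 1 := (Nat.ceil_lt_add_one (by positivity)).le
  set k : ℕ := ⌈5 * q⌉₊ with hkdef
  have hk0 : (0 : ℝ) < k := by linarith
  have hkne : k ≠ 0 := by
    rintro h
    rw [h] at hk0
    simp at hk0
  have hL0 : 0 < L := by linarith
  have hqL : 0 < q * L := by positivity
  have hδT : 1 / (64 * (q * L)) * T = q ^ 2 / (64 * L) := by
    rw [← hq3]; field_simp
  have hloss : 8 / 27 * (4 * (4 * k + 5) / tentMass k) ≤ 8 / 75 / q ^ 2 := by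
    have h1 : 4 * (4 * (k : ℝ) + 5) / tentMass k ≤ 18 * k / (2 * k ^ 3) := by
      refine div_le_div₀ (by positivity) (by linarith) (by positivity) (le_tentMass k)
    have h2 : 18 * (k : ℝ) / (2 * k ^ 3) = 9 / k ^ 2 := by field_simp; norm_num
    have h3 : 9 / (k : ℝ) ^ 2 ≤ 9 / (5 * q) ^ 2 := by gcongr
    have h4 : 8 / 27 * (9 / (5 * q) ^ 2) = 8 / 75 / q ^ 2 := by field_simp; norm_num
    rw [h2] at h1
    linarith
  have hη : q ^ 2 / (64 * L) * (8 / 27 * (4 * (4 * k + 5) / tentMass k)) ≤ 1 / (600 * L) := by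
    refine (mul_le_mul_of_nonneg_left hloss (by positivity)).trans (le_of_eq ?_)
    field_simp
    norm_num
  refine ⟨1 / (64 * (q * L)), k, by positivity, hkne, ?_, ?_, ?_⟩
  · rw [one_div_mul_eq_div, div_le_iff₀ (by positivity)]
    push_cast
    have h1 : 2 * (k : ℝ) ≤ 11 * q := by linarith
    have h2 : D ≤ 13 / 10 * L := by linarith
    have h3 : 2 * (k : ℝ) * D ≤ 11 * q * (13 / 10 * L) :=
      mul_le_mul h1 h2 hD0 (by positivity)
    have h4 : 11 / 5 * (10 / 3) ≤ q * L := mul_le_mul hq hL (by norm_num) hq0.le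
    nlinarith
  · rw [hδT]
    refine (mul_le_mul_of_nonneg_right hη hD0).trans ?_
    rw [one_div_mul_eq_div, div_le_iff₀ (by positivity)]
    linarith
  · rw [hδT, hq2]
    have h1 := (mul_le_mul_of_nonneg_right hη hD0).trans
      (mul_le_mul_of_nonneg_left hD2 (by positivity))
    have h2 : q ^ 2 / (500 * L) = 1 / L * q ^ 2 * (1 / 500) := by field_simp
    have h3 : q ^ 2 / (64 * L) / 4 - 1 / (600 * L) * q ^ 2
        = 1 / L * q ^ 2 * (1 / 256 - 1 / 600) := by field_simp; norm_num
    have h4 : 0 < 1 / L * q ^ 2 := by positivity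
    rw [h2]
    refine lt_of_lt_of_le ?_ (sub_le_sub_left h1 _)
    rw [h3]
    exact mul_lt_mul_of_pos_left (by norm_num) h4

end OnlineLearning

end

theorem theorem3 {A : Type*} [Fintype A] [Nontrivial A]
    {Ω : Type*} [MeasurableSpace Ω] (μ : Measure Ω) [IsProbabilityMeasure μ]
    (T : ℕ) (hT : 10 < T) (π : OnlineLearning.RandomizedPlayer A Ω) :
    ∃ f : OnlineLearning.LossSequence A, f.UnitBounded ∧ f.HasMemory 1 ∧
      (T : ℝ) ^ (2 / 3 : ℝ) / (500 * Real.logb 2 (T : ℝ)) ≤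
        ∫ ω, OnlineLearning.policyRegret π f (T + 1) ω ∂μ := by
  classical
  obtain ⟨δ, k, hδ, hk, hsmall, hηD, hlt⟩ := OnlineLearning.parameter_bounds hT
  obtain ⟨a₀, a₁, hne⟩ := exists_pair_ne A
  set χ : A → Bool := fun a => decide (a = a₁) with hχdef
  have hχ : Function.Surjective χ := by
    intro b
    cases b
    · exact ⟨a₀, by simp [hχdef, hne]⟩
    · exact ⟨a₁, by simp [hχdef]⟩
  have hTD : T < 2 ^ (Nat.log 2 T + 1) := Nat.lt_pow_succ_log_self (by norm_num) T
  by_contra! hcon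
  have hint : ∀ θ z, Integrable
      (OnlineLearning.policyRegret π (OnlineLearning.walkLoss χ δ T θ z) (T + 1)) μ :=
    fun θ z => OnlineLearning.integrable_policyRegret μ π _ _
  have hup : ∀ θ, OnlineLearning.noiseAvg k (fun z => ∫ ω, OnlineLearning.policyRegret π
      (OnlineLearning.walkLoss χ δ T θ z) (T + 1) ω ∂μ) T 1 0
      ≤ (T : ℝ) ^ (2 / 3 : ℝ) / (500 * Real.logb 2 (T : ℝ)) := fun θ =>
    OnlineLearning.noiseAvg_le hk
      (fun z hz => (hcon _ (OnlineLearning.walkLoss_unitBounded χ hδ hTD hsmall θ hz)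
        (OnlineLearning.walkLoss_hasMemory χ δ T θ z)).le) T 1 0 (by simp)
  have hfalse := hup false
  have htrue := hup true
  rw [OnlineLearning.noiseAvg_integral k (hint _)] at hfalse htrue
  -- the value of the game for a fixed outcome of the player's randomness
  have hlow : ∀ ω, δ * T / 2 - 2 * (δ * T * (8 / 27 * (4 * (4 * k + 5)
        / OnlineLearning.tentMass k)) * (Nat.log 2 T + 1 : ℕ))
      ≤ OnlineLearning.noiseAvg k (fun z => OnlineLearning.policyRegret π
          (OnlineLearning.walkLoss χ δ T false z) (T + 1) ω) T 1 0
        + OnlineLearning.noiseAvg k (fun z => OnlineLearning.policyRegret π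
          (OnlineLearning.walkLoss χ δ T true z) (T + 1) ω) T 1 0 := by
    intro ω
    have hM : OnlineLearning.Matched π ω χ δ T 1 0 0 := by
      intro i hi
      obtain rfl : i = 0 := by omega
      rfl
    have h := OnlineLearning.le_noiseAvg_policyRegret π ω hχ hδ hTD hk rfl hηD T 1 0 0 1 1
      one_ne_zero (by omega) hM zero_le_one zero_le_one
    have hS : ∀ x, OnlineLearning.shiftCount x 1 = 0 := fun x => by
      simp [OnlineLearning.shiftCount]
    rw [hS, OnlineLearning.potential] at h
    norm_num at h ⊢
    linarith
  have hsum := integral_mono (integrable_const _)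
    ((OnlineLearning.integrable_noiseAvg k (hint false) T 1 0).add
      (OnlineLearning.integrable_noiseAvg k (hint true) T 1 0)) hlow
  rw [integral_const, probReal_univ, one_smul] at hsum
  simp only [Pi.add_apply] at hsum
  rw [integral_add (OnlineLearning.integrable_noiseAvg k (hint false) T 1 0)
    (OnlineLearning.integrable_noiseAvg k (hint true) T 1 0)] at hsum
  linarith
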